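/- Let $n\ge 1$ and let $|\cdot|$ denote both the Euclidean norm on $\mathbb{R}^n$ and Lebesgue measure. Write $\mathbb{R}^{n+1}_+=\{(y,t): y\in\mathbb{R}^n,\ t>0\}$. For a measurable function $f\colon \mathbb{R}^{n+1}_+\to\mathbb{R}$, $\alpha>0$ and $x\in\mathbb{R}^n$ put $$A^{(\alpha)}(f)(x)=\Big(\int_{\{(y,t)\in\mathbb{R}^{n+1}_+:\ |x-y|<\alpha t\}}|f(y,t)|^2\,\frac{dy\,dt}{t^{n+1}}\Big)^{1/2},\qquad A(f)=A^{(1)}(f),$$ $$C(f)(x)=\sup_{B\ni x}\Big(\frac1{|B|}\int_{\widehat B}|f(y,t)|^2\,\frac{dy\,dt}{t}\Big)^{1/2},$$ both with values in $[0,\infty]$, where the supremum is over all open balls $B=B(z,r)\subset\mathbb{R}^n$ containing $x$, and $\widehat B=\{(y,t)\in\mathbb{R}^{n+1}_+: |z-y|+t<r\}$ is the tent over $B$. There exist constants $\alpha>1$ and $c>0$, depending only on $n$, such that for every measurable $f\colon\mathbb{R}^{n+1}_+\to\mathbb{R}$, all $\lambda>0$ and all $0<\gamma\le 1$, $$\big|\{x\in\mathbb{R}^n: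 A(f)(x)>2\lambda,\ C(f)(x)\le\gamma\lambda\}\big|\le 2e^{-c/\gamma^2}\,\big|\{x\in\mathbb{R}^n: A^{(\alpha)}(f)(x)>\lambda\}\big|.$$ -/

import Mathlib

open MeasureTheory Set
open scoped ENNReal

namespace TentSpace

/-- The open upper half-space `{(y, t) : y ∈ ℝⁿ, t > 0}`, as a subset of `ℝⁿ × ℝ`. -/
def upperHalfSpace (n : ℕ) : Set (EuclideanSpace ℝ (Fin n) × ℝ) :=
  {p | 0 < p.2}

/-- The cone `Γ_α(x)` with vertex `x` and aperture `α`. -/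
def cone {n : ℕ} (α : ℝ) (x : EuclideanSpace ℝ (Fin n)) :
    Set (EuclideanSpace ℝ (Fin n) × ℝ) :=
  {p | p ∈ upperHalfSpace n ∧ ‖x - p.1‖ < α * p.2}

/-- The tent over the ball with centre `z` and radius `r`. -/
def tent {n : ℕ} (z : EuclideanSpace ℝ (Fin n)) (r : ℝ) :
    Set (EuclideanSpace ℝ (Fin n) × ℝ) :=
  {p | p ∈ upperHalfSpace n ∧ ‖z - p.1‖ + p.2 < r}

/-- The conical square function `A^{(α)}(f)(x)`, with values in `[0, ∞]`; only the values of `f`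
on the upper half-space enter. -/
noncomputable def conical {n : ℕ} (α : ℝ) (f : EuclideanSpace ℝ (Fin n) × ℝ → ℝ)
    (x : EuclideanSpace ℝ (Fin n)) : ℝ≥0∞ :=
  (∫⁻ p in cone α x, ENNReal.ofReal (|f p| ^ 2 / p.2 ^ (n + 1))) ^ (1 / 2 : ℝ)

/-- The Carleson function `C(f)(x)`, with values in `[0, ∞]`: the supremum is over all balls
that contain `x` (such a ball has positive radius). -/
noncomputable def carleson {n : ℕ} (f : EuclideanSpace ℝ (Fin n) × ℝ → ℝ)
    (x : EuclideanSpace ℝ (Fin n)) : ℝ≥0∞ :=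
  ⨆ (z : EuclideanSpace ℝ (Fin n)) (r : ℝ) (_ : x ∈ Metric.ball z r),
    ((volume (Metric.ball z r))⁻¹ *
      ∫⁻ p in tent z r, ENNReal.ofReal (|f p| ^ 2 / p.2)) ^ (1 / 2 : ℝ)

end TentSpace

/-!
The aperture on the right-hand side is `2`. Given `x` with `A(f)(x) > 2λ`, let `h` be a height at
which the part of the cone integral above `h` exceeds `λ²` while the part above `2h` does not. A
cone of aperture `2` with vertex in the closed ball `B(x, h)` contains the part of the unit cone at
`x` above height `h`, so `B(x, h)` lies in `{A^(2)(f) > λ}`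
(`closedBall_subset_of_lt_lintegral_cone`); and the part of the cone at `x` below `2h` carries at
least `3λ²`. The Vitali covering lemma selects disjoint balls `B(b, h b)` among these whose
fourfold enlargements cover the exceptional set, and it remains to estimate the exceptional set in
each enlarged ball by an exponentially small multiple of its volume.

Let `E = {C(f) ≤ γλ}`, and let `w` be the square density `|f|² / t ^ (n + 1)` restricted to the
sawtooth region over `E`, the union of the cones with vertex in `E`. Cone integrals with vertex in
`E` do not change, but now the Carleson condition holds over *every* ball, since a tent that meets
the sawtooth region lies over a ball that meets `E` (`lintegral_tent_sawtooth_le`).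

The local exponential estimate `volume_truncated_cone_integral_ge_le` comes from integrals iterated
with decreasing heights: `J₀ = 1`, and `J_{k+1}(x, h)` is the integral of `w(y, t) J_k(x, t)` over
the cone at `x` cut at height `h`. By symmetry, the `k`-th power of the cone integral cut at `h` is
at most `k! J_k` (`measure_pow_le_factorial_mul`). By Tonelli, integrating `J_{k+1}` over a ball of
radius `h` leads to integrals of `J_k(·, t)` over balls of radius `t ≤ h`, each with centre `y` for
a point `(y, t)` of the tent over the threefold ball, so the Carleson condition gives a bound that
is geometric in `k` (`lintegral_ball_iteratedIntegral_le`). Summing the exponential series and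
applying Chebyshev's inequality finishes the local estimate. The prefactor `2 * 4 ^ n` left by the
covering argument is reduced to `2` by making the constant in the exponent smaller.
-/

namespace TentSpace

/-! ### Integrals iterated with decreasing heights -/

section Iterated

variable {X : Type*} [MeasurableSpace X]

/-- The `k`-fold iterated integral of `1` against `ν`, over the points `(p₁, …, p_k)` with heights
`h ≥ τ p₁ ≥ ⋯ ≥ τ p_k`. Ties are allowed, so that no assumption on atoms of the distribution of
`τ` is needed in `measure_pow_le_factorial_mul`. -/
noncomputable def iteratedIntegral (ν : Measure X) (τ : X → ℝ) : ℕ → ℝ → ℝ≥0∞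
  | 0, _ => 1
  | k + 1, h => ∫⁻ p in {p | τ p ≤ h}, iteratedIntegral ν τ k (τ p) ∂ν

theorem monotone_iteratedIntegral (ν : Measure X) (τ : X → ℝ) (k : ℕ) :
    Monotone (iteratedIntegral ν τ k) := by
  cases k with
  | zero => exact monotone_const
  | succ k =>
    intro a b hab
    exact lintegral_mono_set fun p (hp : τ p ≤ a) => hp.trans hab

/-- Multiplying by the measure of `{τ ≤ h}` inserts a new point, which can take any of `k + 1`
positions in the ordering by height. -/
theorem measure_mul_iteratedIntegral_le (ν : Measure X) [SFinite ν] {τ : X → ℝ}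
    (hτ : Measurable τ) (k : ℕ) (h : ℝ) :
    ν {p | τ p ≤ h} * iteratedIntegral ν τ k h ≤ (k + 1) * iteratedIntegral ν τ (k + 1) h := by
  induction k generalizing h with
  | zero => simp [iteratedIntegral]
  | succ k ih =>
    set A := {p | τ p ≤ h}
    set I := iteratedIntegral ν τ
    have hmA : MeasurableSet A := hτ measurableSet_Iic
    have hmI : ∀ j, Measurable fun p => I j (τ p) := fun j =>
      (monotone_iteratedIntegral ν τ j).measurable.comp hτ
    have hs : ∀ t : ℝ, MeasurableSet {p | τ p ≤ t} := fun t => hτ measurableSet_Iic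
    -- split the square `A × A` according to which of the two heights is larger
    calc ν A * I (k + 1) h
        = ∫⁻ _ in A, (∫⁻ q in A, I k (τ q) ∂ν) ∂ν := by
          rw [setLIntegral_const, mul_comm]; rfl
      _ ≤ ∫⁻ p in A, ((∫⁻ q in A, {q | τ p ≤ τ q}.indicator (fun q => I k (τ q)) q ∂ν) +
            I (k + 1) (τ p)) ∂ν := by
          refine setLIntegral_mono' hmA fun p hp => ?_
          have : I (k + 1) (τ p) =
              ∫⁻ q in A, {q | τ q ≤ τ p}.indicator (fun q => I k (τ q)) q ∂ν := by
            rw [setLIntegral_indicator (hs _)]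
            have : {q | τ q ≤ τ p} ∩ A = {q | τ q ≤ τ p} :=
              inter_eq_left.2 fun q (hq : τ q ≤ τ p) => hq.trans hp
            rw [this]; rfl
          rw [this, ← lintegral_add_right _ ((hmI k).indicator (hs _))]
          refine lintegral_mono fun q => ?_
          rcases le_total (τ p) (τ q) with hpq | hpq
          · simp [hpq]
          · simp [hpq]
      _ = (∫⁻ p in A, (∫⁻ q in A, {q | τ p ≤ τ q}.indicator (fun q => I k (τ q)) q ∂ν) ∂ν) +
            I (k + 2) h := by
          rw [lintegral_add_right _ (hmI _)]; rfl
      _ = (∫⁻ q in A, ν {p | τ p ≤ τ q} * I k (τ q) ∂ν) + I (k + 2) h := by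
          congr 1
          have hm : Measurable fun z : X × X =>
              {z : X × X | τ z.1 ≤ τ z.2}.indicator (fun z => I k (τ z.2)) z :=
            ((hmI k).comp measurable_snd).indicator
              (measurableSet_le (hτ.comp measurable_fst) (hτ.comp measurable_snd))
          have := lintegral_lintegral_swap (μ := ν.restrict A) (ν := ν.restrict A)
            (f := fun p q => {z : X × X | τ z.1 ≤ τ z.2}.indicator (fun z => I k (τ z.2)) (p, q))
            hm.aemeasurable
          refine Eq.trans this (setLIntegral_congr_fun hmA fun q hq => ?_)
          change ∫⁻ p in A, {p | τ p ≤ τ q}.indicator (fun _ => I k (τ q)) p ∂ν = _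
          rw [setLIntegral_indicator (hs _), setLIntegral_const, mul_comm]
          congr 2
          exact inter_eq_left.2 fun p (hp : τ p ≤ τ q) => hp.trans hq
      _ ≤ (∫⁻ q in A, (k + 1) * I (k + 1) (τ q) ∂ν) + I (k + 2) h := by
          exact add_le_add_left (lintegral_mono fun q => ih (τ q)) _
      _ = ((k + 1 : ℕ) + 1) * I (k + 1 + 1) h := by
          rw [lintegral_const_mul _ (hmI _)]
          have : ∫⁻ q in A, I (k + 1) (τ q) ∂ν = I (k + 2) h := rfl
          rw [this]; push_cast; ring

/-- The `k`-th power of the measure of `{τ ≤ h}` is the measure of a cube, which is covered by `k!`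
copies of the region of decreasing heights. -/
theorem measure_pow_le_factorial_mul (ν : Measure X) [SFinite ν] {τ : X → ℝ}
    (hτ : Measurable τ) (k : ℕ) (h : ℝ) :
    ν {p | τ p ≤ h} ^ k ≤ k.factorial * iteratedIntegral ν τ k h := by
  induction k with
  | zero => simp [iteratedIntegral]
  | succ k ih =>
    calc ν {p | τ p ≤ h} ^ (k + 1) = ν {p | τ p ≤ h} * ν {p | τ p ≤ h} ^ k := pow_succ' _ _
      _ ≤ ν {p | τ p ≤ h} * (k.factorial * iteratedIntegral ν τ k h) := by gcongr
      _ = k.factorial * (ν {p | τ p ≤ h} * iteratedIntegral ν τ k h) := by ring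
      _ ≤ k.factorial * ((k + 1) * iteratedIntegral ν τ (k + 1) h) := by
          exact mul_le_mul_right (measure_mul_iteratedIntegral_le ν hτ k h) _
      _ = _ := by rw [Nat.factorial_succ]; push_cast; ring

/-- Exponential series form of `measure_pow_le_factorial_mul`; it bounds the exponential of the
measure of `{τ ≤ h}` without assuming that measure finite. -/
theorem ofReal_exp_le_tsum_iteratedIntegral (ν : Measure X) [SFinite ν] {τ : X → ℝ}
    (hτ : Measurable τ) {h κ s : ℝ} (hκ : 0 ≤ κ) (hs : 0 ≤ s)
    (hsν : ENNReal.ofReal s ≤ ν {p | τ p ≤ h}) :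
    ENNReal.ofReal (Real.exp (κ * s)) ≤
      ∑' k, ENNReal.ofReal κ ^ k * iteratedIntegral ν τ k h := by
  have hexp : Real.exp (κ * s) = ∑' k : ℕ, (κ * s) ^ k / k.factorial := by
    rw [Real.exp_eq_exp_ℝ, NormedSpace.exp_eq_tsum_div]
  rw [hexp, ENNReal.ofReal_tsum_of_nonneg (fun k => by positivity)
    (Real.summable_pow_div_factorial _)]
  refine ENNReal.tsum_le_tsum fun k => ?_
  rw [ENNReal.ofReal_div_of_pos (by positivity), ENNReal.ofReal_natCast]
  refine ENNReal.div_le_of_le_mul ?_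
  rw [mul_pow, ENNReal.ofReal_mul (by positivity), ENNReal.ofReal_pow hκ, ENNReal.ofReal_pow hs,
    mul_assoc]
  gcongr
  rw [mul_comm]
  exact (pow_le_pow_left' hsν k).trans (measure_pow_le_factorial_mul ν hτ k h)

end Iterated

/-! ### Exponential estimate for densities satisfying a Carleson condition -/

section Carleson

variable {n : ℕ}

/-- The measure with density `w` on the cone of aperture `1` with vertex `x`. -/
noncomputable def coneMeasure (w : EuclideanSpace ℝ (Fin n) × ℝ → ℝ≥0∞)
    (x : EuclideanSpace ℝ (Fin n)) : Measure (EuclideanSpace ℝ (Fin n) × ℝ) :=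
  (volume.restrict (cone 1 x)).withDensity w

instance (w : EuclideanSpace ℝ (Fin n) × ℝ → ℝ≥0∞) (x : EuclideanSpace ℝ (Fin n)) :
    SFinite (coneMeasure w x) :=
  inferInstanceAs (SFinite ((volume.restrict (cone 1 x)).withDensity w))

theorem measurableSet_cone (α : ℝ) (x : EuclideanSpace ℝ (Fin n)) :
    MeasurableSet (cone α x) := by
  have h1 : MeasurableSet {p : EuclideanSpace ℝ (Fin n) × ℝ | 0 < p.2} :=
    measurableSet_lt (by fun_prop) (by fun_prop)
  have h2 : MeasurableSet {p : EuclideanSpace ℝ (Fin n) × ℝ | ‖x - p.1‖ < α * p.2} :=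
    measurableSet_lt (by fun_prop) (by fun_prop)
  exact h1.inter h2

theorem measurableSet_tent (z : EuclideanSpace ℝ (Fin n)) (r : ℝ) :
    MeasurableSet (tent z r) := by
  have h1 : MeasurableSet {p : EuclideanSpace ℝ (Fin n) × ℝ | 0 < p.2} :=
    measurableSet_lt (by fun_prop) (by fun_prop)
  have h2 : MeasurableSet {p : EuclideanSpace ℝ (Fin n) × ℝ | ‖z - p.1‖ + p.2 < r} :=
    measurableSet_lt (by fun_prop) (by fun_prop)
  exact h1.inter h2

theorem measurableSet_truncated_cone_relation :
    MeasurableSet {q : (EuclideanSpace ℝ (Fin n) × ℝ) × EuclideanSpace ℝ (Fin n) × ℝ |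
      q.2 ∈ cone 1 q.1.1 ∧ q.2.2 ≤ q.1.2} := by
  have h1 : MeasurableSet {q : (EuclideanSpace ℝ (Fin n) × ℝ) × EuclideanSpace ℝ (Fin n) × ℝ |
      0 < q.2.2} := measurableSet_lt (by fun_prop) (by fun_prop)
  have h2 : MeasurableSet {q : (EuclideanSpace ℝ (Fin n) × ℝ) × EuclideanSpace ℝ (Fin n) × ℝ |
      ‖q.1.1 - q.2.1‖ < 1 * q.2.2} := measurableSet_lt (by fun_prop) (by fun_prop)
  have h3 : MeasurableSet {q : (EuclideanSpace ℝ (Fin n) × ℝ) × EuclideanSpace ℝ (Fin n) × ℝ |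
      q.2.2 ≤ q.1.2} := measurableSet_le (by fun_prop) (by fun_prop)
  exact (h1.inter h2).inter h3

theorem iteratedIntegral_coneMeasure_succ {w : EuclideanSpace ℝ (Fin n) × ℝ → ℝ≥0∞}
    (hw : Measurable w) (x : EuclideanSpace ℝ (Fin n)) (k : ℕ) (h : ℝ) :
    iteratedIntegral (coneMeasure w x) Prod.snd (k + 1) h =
      ∫⁻ p, {p | p ∈ cone 1 x ∧ p.2 ≤ h}.indicator
        (fun p => w p * iteratedIntegral (coneMeasure w x) Prod.snd k p.2) p := by
  have hA : MeasurableSet {p : EuclideanSpace ℝ (Fin n) × ℝ | p.2 ≤ h} :=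
    measurableSet_le measurable_snd measurable_const
  have hm : Measurable fun p : EuclideanSpace ℝ (Fin n) × ℝ =>
      iteratedIntegral (coneMeasure w x) Prod.snd k p.2 :=
    (monotone_iteratedIntegral _ _ k).measurable.comp measurable_snd
  have hset : {p | p ∈ cone 1 x ∧ p.2 ≤ h} = {p | p.2 ≤ h} ∩ cone 1 x := by
    ext p; exact and_comm
  rw [hset, lintegral_indicator (hA.inter (measurableSet_cone 1 x)), ← Measure.restrict_restrict hA]
  change ∫⁻ p in {p : EuclideanSpace ℝ (Fin n) × ℝ | p.2 ≤ h}, _ ∂coneMeasure w x = _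
  conv_lhs => rw [coneMeasure, restrict_withDensity hA]
  exact lintegral_withDensity_eq_lintegral_mul _ hw hm

theorem measurable_iteratedIntegral_coneMeasure {w : EuclideanSpace ℝ (Fin n) × ℝ → ℝ≥0∞}
    (hw : Measurable w) (k : ℕ) :
    Measurable fun q : EuclideanSpace ℝ (Fin n) × ℝ =>
      iteratedIntegral (coneMeasure w q.1) Prod.snd k q.2 := by
  induction k with
  | zero => exact measurable_const
  | succ k ih =>
    simp only [iteratedIntegral_coneMeasure_succ hw]
    have hm : Measurable fun z : (EuclideanSpace ℝ (Fin n) × ℝ) × EuclideanSpace ℝ (Fin n) × ℝ =>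
        w z.2 * iteratedIntegral (coneMeasure w z.1.1) Prod.snd k z.2.2 :=
      (hw.comp measurable_snd).mul
        (ih.comp ((measurable_fst.comp measurable_fst).prodMk (measurable_snd.comp measurable_snd)))
    exact (hm.indicator measurableSet_truncated_cone_relation).lintegral_prod_right'

theorem measurable_iteratedIntegral_coneMeasure_left
    {w : EuclideanSpace ℝ (Fin n) × ℝ → ℝ≥0∞} (hw : Measurable w) (k : ℕ) (h : ℝ) :
    Measurable fun x : EuclideanSpace ℝ (Fin n) =>
      iteratedIntegral (coneMeasure w x) Prod.snd k h :=
  Measurable.of_uncurry_right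
    (f := fun x : EuclideanSpace ℝ (Fin n) => iteratedIntegral (coneMeasure w x) Prod.snd k)
    (measurable_iteratedIntegral_coneMeasure hw k)

/-- Under a Carleson condition, averages over a ball of radius `h` of the `k`-fold iterated cone
integrals cut at the same height `h` grow at most geometrically in `k`. The matching of the radius
with the height is what lets the induction close: a point `(y, t)` lies in the cone at `x` exactly
when `x` lies in the ball `B(y, t)`. -/
theorem lintegral_ball_iteratedIntegral_le {w : EuclideanSpace ℝ (Fin n) × ℝ → ℝ≥0∞}
    (hw : Measurable w) {K : ℝ≥0∞}
    (hK : ∀ z r, 0 < r → ∫⁻ p in tent z r, w p * volume (Metric.ball p.1 p.2) ≤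
      K * volume (Metric.ball z r))
    (k : ℕ) (z : EuclideanSpace ℝ (Fin n)) {h : ℝ} (hh : 0 < h) :
    ∫⁻ x in Metric.ball z h, iteratedIntegral (coneMeasure w x) Prod.snd k h ≤
      (3 ^ n * K) ^ k * volume (Metric.ball z h) := by
  induction k generalizing z h with
  | zero => simp [iteratedIntegral]
  | succ k ih =>
    set J : EuclideanSpace ℝ (Fin n) → ℝ → ℝ≥0∞ :=
      fun x => iteratedIntegral (coneMeasure w x) Prod.snd k with hJ
    have hJm : Measurable fun q : EuclideanSpace ℝ (Fin n) × ℝ => J q.1 q.2 :=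
      measurable_iteratedIntegral_coneMeasure hw k
    have hS : MeasurableSet {q : EuclideanSpace ℝ (Fin n) × EuclideanSpace ℝ (Fin n) × ℝ |
        q.2 ∈ cone 1 q.1 ∧ q.2.2 ≤ h} := by
      have hφ : Measurable fun q : EuclideanSpace ℝ (Fin n) × EuclideanSpace ℝ (Fin n) × ℝ =>
          ((q.1, h), q.2) := by fun_prop
      exact hφ measurableSet_truncated_cone_relation
    have hm : Measurable fun q : EuclideanSpace ℝ (Fin n) × EuclideanSpace ℝ (Fin n) × ℝ =>
        {q : EuclideanSpace ℝ (Fin n) × EuclideanSpace ℝ (Fin n) × ℝ |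
          q.2 ∈ cone 1 q.1 ∧ q.2.2 ≤ h}.indicator (fun q => w q.2 * J q.1 q.2.2) q :=
      ((hw.comp measurable_snd).mul (hJm.comp
        (measurable_fst.prodMk (measurable_snd.comp measurable_snd)))).indicator hS
    calc ∫⁻ x in Metric.ball z h, iteratedIntegral (coneMeasure w x) Prod.snd (k + 1) h
        = ∫⁻ x in Metric.ball z h, ∫⁻ p, {p | p ∈ cone 1 x ∧ p.2 ≤ h}.indicator
            (fun p => w p * J x p.2) p := by
          simp only [iteratedIntegral_coneMeasure_succ hw, hJ]
      _ = ∫⁻ p, ∫⁻ x in Metric.ball z h, {p | p ∈ cone 1 x ∧ p.2 ≤ h}.indicator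
            (fun p => w p * J x p.2) p :=
          lintegral_lintegral_swap (f := fun x p => {q : EuclideanSpace ℝ (Fin n) ×
            EuclideanSpace ℝ (Fin n) × ℝ | q.2 ∈ cone 1 q.1 ∧ q.2.2 ≤ h}.indicator
              (fun q => w q.2 * J q.1 q.2.2) (x, p)) hm.aemeasurable
      _ ≤ ∫⁻ p, (tent z (3 * h)).indicator
            (fun p => w p * ∫⁻ x in Metric.ball p.1 p.2, J x p.2) p := by
          refine lintegral_mono fun p => ?_
          have hJp : Measurable fun x => J x p.2 := 
            measurable_iteratedIntegral_coneMeasure_left hw k p.2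
          by_cases hp : p ∈ tent z (3 * h)
          · rw [indicator_of_mem hp, ← lintegral_const_mul _ hJp,
              ← lintegral_indicator (Metric.isOpen_ball (x := p.1) (ε := p.2)).measurableSet]
            refine (setLIntegral_le_lintegral _ _).trans (lintegral_mono fun x => ?_)
            refine indicator_le' (s := {p | p ∈ cone 1 x ∧ p.2 ≤ h})
              (f := fun p => w p * J x p.2)
              (g := fun p => (Metric.ball p.1 p.2).indicator (fun x => w p * J x p.2) x) ?_ ?_ p
            · rintro q ⟨⟨-, hq⟩, -⟩
              rw [indicator_of_mem]
              rw [mem_ball_iff_norm]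
              simpa using hq
            · exact fun _ _ => zero_le
          · -- the cones with vertices in the ball, cut at height `h`, stay in the larger tent
            rw [indicator_of_notMem hp]
            refine le_of_eq ((setLIntegral_congr_fun Metric.isOpen_ball.measurableSet
              fun x hx => ?_).trans (lintegral_zero))
            refine indicator_of_notMem ?_ _
            rintro ⟨⟨h0, hq⟩, hh'⟩
            refine hp ⟨h0, ?_⟩
            have h1 : ‖z - x‖ < h := by simpa [dist_eq_norm, norm_sub_rev] using hx
            have h2 : ‖z - p.1‖ ≤ ‖z - x‖ + ‖x - p.1‖ := norm_sub_le_norm_sub_add_norm_sub _ _ _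
            linarith
      _ = ∫⁻ p in tent z (3 * h), w p * ∫⁻ x in Metric.ball p.1 p.2, J x p.2 :=
          lintegral_indicator (measurableSet_tent _ _) _
      _ ≤ ∫⁻ p in tent z (3 * h), (3 ^ n * K) ^ k * (w p * volume (Metric.ball p.1 p.2)) := by
          refine setLIntegral_mono' (measurableSet_tent _ _) fun p hp => ?_
          refine (mul_le_mul_right (ih p.1 hp.1) _).trans (le_of_eq ?_)
          ring
      _ = (3 ^ n * K) ^ k * ∫⁻ p in tent z (3 * h), w p * volume (Metric.ball p.1 p.2) := by
          refine lintegral_const_mul _ (hw.mul ?_)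
          simp_rw [Measure.addHaar_ball_center volume]
          have hmono : Monotone fun r : ℝ => volume (Metric.ball (0 : EuclideanSpace ℝ (Fin n)) r) :=
            fun a b hab => measure_mono (Metric.ball_subset_ball hab)
          exact hmono.measurable.comp measurable_snd
      _ ≤ (3 ^ n * K) ^ k * (K * volume (Metric.ball z (3 * h))) := by
          gcongr
          exact hK z _ (by positivity)
      _ = (3 ^ n * K) ^ (k + 1) * volume (Metric.ball z h) := by
          rw [Measure.addHaar_ball_mul_of_pos _ _ (by norm_num : (0 : ℝ) < 3),
            Measure.addHaar_ball_center, finrank_euclideanSpace_fin,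
            ENNReal.ofReal_pow (by norm_num), ENNReal.ofReal_ofNat,
            Measure.addHaar_ball_center volume z]
          ring

/-- John–Nirenberg type estimate: the cone integral of a density satisfying a Carleson condition is
exponentially integrable on balls. -/
theorem volume_truncated_cone_integral_ge_le {w : EuclideanSpace ℝ (Fin n) × ℝ → ℝ≥0∞}
    (hw : Measurable w) {K : ℝ} (hKpos : 0 < K)
    (hK : ∀ z r, 0 < r → ∫⁻ p in tent z r, w p * volume (Metric.ball p.1 p.2) ≤
      ENNReal.ofReal K * volume (Metric.ball z r))
    (z : EuclideanSpace ℝ (Fin n)) {h s : ℝ} (hh : 0 < h) (hs : 0 ≤ s) :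
    volume {x ∈ Metric.ball z h |
        ENNReal.ofReal s ≤ ∫⁻ p in {p | p ∈ cone 1 x ∧ p.2 ≤ h}, w p} ≤
      ENNReal.ofReal (2 * Real.exp (-(s / (2 * 3 ^ n * K)))) * volume (Metric.ball z h) := by
  -- this choice makes the geometric series below have ratio `1 / 2`
  set κ : ℝ := (2 * 3 ^ n * K)⁻¹ with hκ
  have hκ0 : 0 < κ := by positivity
  set P : EuclideanSpace ℝ (Fin n) → ℝ≥0∞ := fun x =>
    ∑' k, ENNReal.ofReal κ ^ k * iteratedIntegral (coneMeasure w x) Prod.snd k h with hP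
  have hJm : ∀ k, Measurable fun x : EuclideanSpace ℝ (Fin n) =>
      iteratedIntegral (coneMeasure w x) Prod.snd k h := fun k =>
    measurable_iteratedIntegral_coneMeasure_left hw k h
  have hPm : Measurable P := Measurable.tsum fun k => (hJm k).const_mul _
  have hκK : ENNReal.ofReal κ * (3 ^ n * ENNReal.ofReal K) = 2⁻¹ := by
    have h3 : (3 : ℝ≥0∞) ^ n = ENNReal.ofReal (3 ^ n) := by
      rw [ENNReal.ofReal_pow (by norm_num), ENNReal.ofReal_ofNat]
    rw [h3, ← ENNReal.ofReal_mul (by positivity), ← ENNReal.ofReal_mul hκ0.le]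
    have : κ * (3 ^ n * K) = 2⁻¹ := by rw [hκ]; field_simp
    rw [this, ENNReal.ofReal_inv_of_pos two_pos, ENNReal.ofReal_ofNat]
  have hint : ∫⁻ x in Metric.ball z h, P x ≤ 2 * volume (Metric.ball z h) := by
    rw [hP, lintegral_tsum fun k => ((hJm k).const_mul _).aemeasurable]
    calc _ ≤ ∑' k : ℕ, (2⁻¹ : ℝ≥0∞) ^ k * volume (Metric.ball z h) := by
          refine ENNReal.tsum_le_tsum fun k => ?_
          rw [lintegral_const_mul _ (hJm k)]
          refine (mul_le_mul_right (lintegral_ball_iteratedIntegral_le hw hK k z hh) _).trans ?_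
          rw [← mul_assoc, ← mul_pow, hκK]
      _ = 2 * volume (Metric.ball z h) := by
          rw [ENNReal.tsum_mul_right, ENNReal.tsum_geometric_two]
  have hsub : {x ∈ Metric.ball z h |
      ENNReal.ofReal s ≤ ∫⁻ p in {p | p ∈ cone 1 x ∧ p.2 ≤ h}, w p} ⊆
      {x | ENNReal.ofReal (Real.exp (κ * s)) ≤ P x} ∩ Metric.ball z h := by
    rintro x ⟨hx, hsx⟩
    have hA : MeasurableSet {p : EuclideanSpace ℝ (Fin n) × ℝ | p.2 ≤ h} :=
      measurableSet_le measurable_snd measurable_const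
    have hcone : coneMeasure w x {p | p.2 ≤ h} = ∫⁻ p in {p | p ∈ cone 1 x ∧ p.2 ≤ h}, w p := by
      rw [coneMeasure, withDensity_apply _ hA, Measure.restrict_restrict hA, inter_comm]
      rfl
    have hPx := ofReal_exp_le_tsum_iteratedIntegral (coneMeasure w x) (τ := Prod.snd) (h := h)
      measurable_snd hκ0.le hs (by rw [hcone]; exact hsx)
    exact ⟨hPx, hx⟩
  have hcheb := (mul_meas_ge_le_lintegral (μ := volume.restrict (Metric.ball z h)) hPm
    (ENNReal.ofReal (Real.exp (κ * s)))).trans hint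
  rw [Measure.restrict_apply' Metric.isOpen_ball.measurableSet] at hcheb
  refine (measure_mono hsub).trans ?_
  have hexp : ENNReal.ofReal (2 * Real.exp (-(s / (2 * 3 ^ n * K)))) =
      2 * (ENNReal.ofReal (Real.exp (κ * s)))⁻¹ := by
    rw [ENNReal.ofReal_mul two_pos.le, ENNReal.ofReal_ofNat, Real.exp_neg,
      ENNReal.ofReal_inv_of_pos (Real.exp_pos _), hκ, div_eq_inv_mul]
  rw [hexp, mul_right_comm, ← div_eq_mul_inv,
    ENNReal.le_div_iff_mul_le (Or.inl (by simp [Real.exp_pos])) (Or.inl ENNReal.ofReal_ne_top),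
    mul_comm]
  exact hcheb

end Carleson

/-! ### Sawtooth localization and covering -/

section GoodLambda

variable {n : ℕ}

/-- The density `|f|² / t ^ (n + 1)` integrated over cones by the conical square function. -/
noncomputable def squareDensity (f : EuclideanSpace ℝ (Fin n) × ℝ → ℝ)
    (p : EuclideanSpace ℝ (Fin n) × ℝ) : ℝ≥0∞ :=
  ENNReal.ofReal (|f p| ^ 2 / p.2 ^ (n + 1))

theorem measurable_squareDensity {f : EuclideanSpace ℝ (Fin n) × ℝ → ℝ} (hf : Measurable f) :
    Measurable (squareDensity f) := by
  unfold squareDensity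
  fun_prop

theorem conical_congr_ae {f g : EuclideanSpace ℝ (Fin n) × ℝ → ℝ}
    (hfg : f =ᵐ[volume.restrict (upperHalfSpace n)] g) (α : ℝ) : conical α f = conical α g := by
  ext x
  unfold conical
  congr 1
  refine lintegral_congr_ae ?_
  have hsub : cone α x ⊆ upperHalfSpace n := fun p hp => hp.1
  filter_upwards [ae_restrict_of_ae_restrict_of_subset hsub hfg] with p hp
  rw [hp]

theorem carleson_congr_ae {f g : EuclideanSpace ℝ (Fin n) × ℝ → ℝ}
    (hfg : f =ᵐ[volume.restrict (upperHalfSpace n)] g) : carleson f = carleson g := by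
  ext x
  unfold carleson
  refine iSup_congr fun z => iSup_congr fun r => iSup_congr fun _ => ?_
  congr 2
  refine lintegral_congr_ae ?_
  have hsub : tent z r ⊆ upperHalfSpace n := fun p hp => hp.1
  filter_upwards [ae_restrict_of_ae_restrict_of_subset hsub hfg] with p hp
  rw [hp]

theorem ofReal_lt_conical_iff {α a : ℝ} (ha : 0 ≤ a) {f : EuclideanSpace ℝ (Fin n) × ℝ → ℝ}
    {x : EuclideanSpace ℝ (Fin n)} :
    ENNReal.ofReal a < conical α f x ↔
      ENNReal.ofReal (a ^ 2) < ∫⁻ p in cone α x, squareDensity f p := by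
  unfold conical
  rw [one_div, ENNReal.lt_rpow_inv_iff two_pos, ENNReal.rpow_two, ENNReal.ofReal_pow ha]
  rfl

theorem lintegral_tent_le_of_carleson_le {f : EuclideanSpace ℝ (Fin n) × ℝ → ℝ}
    {x z : EuclideanSpace ℝ (Fin n)} {r β : ℝ} (hβ : 0 ≤ β) (hx : x ∈ Metric.ball z r)
    (hC : carleson f x ≤ ENNReal.ofReal β) :
    ∫⁻ p in tent z r, ENNReal.ofReal (|f p| ^ 2 / p.2) ≤
      ENNReal.ofReal (β ^ 2) * volume (Metric.ball z r) := by
  have h1 : ((volume (Metric.ball z r))⁻¹ *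
      ∫⁻ p in tent z r, ENNReal.ofReal (|f p| ^ 2 / p.2)) ^ (1 / 2 : ℝ) ≤ ENNReal.ofReal β := by
    simp only [carleson, iSup_le_iff] at hC
    exact hC z r hx
  rw [one_div, ENNReal.rpow_inv_le_iff two_pos, ENNReal.rpow_two, ← ENNReal.ofReal_pow hβ,
    mul_comm, ← div_eq_mul_inv] at h1
  have hr : 0 < r := Metric.pos_of_mem_ball hx
  exact (ENNReal.div_le_iff (Metric.measure_ball_pos _ _ hr).ne' measure_ball_lt_top.ne).1 h1

/-- The sawtooth region over `E`: the union of the cones of aperture `1` with vertex in `E`. -/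
def sawtooth (E : Set (EuclideanSpace ℝ (Fin n))) : Set (EuclideanSpace ℝ (Fin n) × ℝ) :=
  ⋃ x ∈ E, cone 1 x

theorem measurableSet_sawtooth (E : Set (EuclideanSpace ℝ (Fin n))) :
    MeasurableSet (sawtooth E) := by
  refine (isOpen_biUnion fun x _ => ?_).measurableSet
  have h1 : IsOpen {p : EuclideanSpace ℝ (Fin n) × ℝ | 0 < p.2} :=
    isOpen_lt (by fun_prop) (by fun_prop)
  have h2 : IsOpen {p : EuclideanSpace ℝ (Fin n) × ℝ | ‖x - p.1‖ < 1 * p.2} :=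
    isOpen_lt (by fun_prop) (by fun_prop)
  exact h1.inter h2

/-- If `C(f) ≤ β` on `E`, then the square density of `f` restricted to the sawtooth region over `E`
satisfies a Carleson condition over all balls, whether or not they meet `E`. The factor
`volume (ball p.1 p.2)`, a multiple of `t ^ n`, turns `dy dt / t ^ (n + 1)` into `dy dt / t`. -/
theorem lintegral_tent_sawtooth_le {f : EuclideanSpace ℝ (Fin n) × ℝ → ℝ}
    {E : Set (EuclideanSpace ℝ (Fin n))} {β : ℝ} (hβ : 0 ≤ β)
    (hE : ∀ x ∈ E, carleson f x ≤ ENNReal.ofReal β) (z : EuclideanSpace ℝ (Fin n)) (r : ℝ) :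
    ∫⁻ p in tent z r, (sawtooth E).indicator (squareDensity f) p *
        volume (Metric.ball p.1 p.2) ≤
      ENNReal.ofReal (volume.real (Metric.ball (0 : EuclideanSpace ℝ (Fin n)) 1) * β ^ 2) *
        volume (Metric.ball z r) := by
  set ω := volume (Metric.ball (0 : EuclideanSpace ℝ (Fin n)) 1)
  have hωtop : ω ≠ ∞ := measure_ball_lt_top.ne
  by_cases hne : (tent z r ∩ sawtooth E).Nonempty
  · obtain ⟨p₀, hp₀, hS⟩ := hne
    obtain ⟨x, hxE, hx⟩ := mem_iUnion₂.1 hS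
    -- a cone that meets the tent over a ball has its vertex in the ball
    have hxz : x ∈ Metric.ball z r := by
      rw [mem_ball_iff_norm']
      have h1 : ‖z - x‖ ≤ ‖z - p₀.1‖ + ‖p₀.1 - x‖ := norm_sub_le_norm_sub_add_norm_sub _ _ _
      have h2 := hp₀.2
      have h3 := hx.2
      rw [norm_sub_rev, one_mul] at h3
      linarith
    calc _ ≤ ∫⁻ p in tent z r, ω * ENNReal.ofReal (|f p| ^ 2 / p.2) := by
          refine setLIntegral_mono' (measurableSet_tent z r) fun p hp => ?_
          have hp0 : 0 < p.2 := hp.1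
          calc _ ≤ squareDensity f p * volume (Metric.ball p.1 p.2) := by
                gcongr
                exact indicator_le_self _ _ _
            _ = ω * ENNReal.ofReal (|f p| ^ 2 / p.2) := by
                rw [Measure.addHaar_ball_of_pos _ _ hp0, finrank_euclideanSpace_fin, squareDensity,
                  ← mul_assoc, ← ENNReal.ofReal_mul (by positivity), mul_comm]
                congr 2
                field_simp
                ring
      _ = ω * ∫⁻ p in tent z r, ENNReal.ofReal (|f p| ^ 2 / p.2) :=
          lintegral_const_mul' _ _ hωtop
      _ ≤ ω * (ENNReal.ofReal (β ^ 2) * volume (Metric.ball z r)) := by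
          gcongr
          exact lintegral_tent_le_of_carleson_le hβ hxz (hE x hxE)
      _ = _ := by
          rw [ENNReal.ofReal_mul measureReal_nonneg, Measure.real, ENNReal.ofReal_toReal hωtop,
            mul_assoc]
  · refine le_of_eq_of_le ?_ zero_le
    refine (setLIntegral_congr_fun (measurableSet_tent z r) fun p hp => ?_).trans lintegral_zero
    have : p ∉ sawtooth E := fun hS => hne ⟨p, hp, hS⟩
    simp [this]

/-- Stopping height: doubling `h` as long as `L < φ h` must end below the bound `R`. -/
theorem exists_lt_and_two_mul_le {φ : ℝ → ℝ≥0∞} {L : ℝ≥0∞} {R h₀ : ℝ} (hh₀ : 0 < h₀)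
    (hφ : L < φ h₀) (hR : ∀ h, 0 < h → L < φ h → h ≤ R) :
    ∃ h, 0 < h ∧ L < φ h ∧ φ (2 * h) ≤ L := by
  by_contra! hcon
  have key : ∀ k : ℕ, L < φ (2 ^ k * h₀) := by
    intro k
    induction k with
    | zero => simpa using hφ
    | succ k ih =>
      have := hcon _ (by positivity) ih
      rwa [← mul_assoc, ← pow_succ'] at this
  obtain ⟨k, hk⟩ := pow_unbounded_of_one_lt (R / h₀) one_lt_two
  have := hR _ (by positivity) (key k)
  rw [div_lt_iff₀ hh₀] at hk
  linarith

/-- Moving the vertex of a cone by at most `h` while doubling the aperture does not lose points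
above height `h`. -/
theorem closedBall_subset_of_lt_lintegral_cone {f : EuclideanSpace ℝ (Fin n) × ℝ → ℝ}
    {lam h : ℝ} (hlam : 0 ≤ lam) {x : EuclideanSpace ℝ (Fin n)}
    (hx : ENNReal.ofReal (lam ^ 2) < ∫⁻ p in {p | p ∈ cone 1 x ∧ h < p.2}, squareDensity f p) :
    Metric.closedBall x h ⊆ {y | ENNReal.ofReal lam < conical 2 f y} := by
  intro y hy
  refine (ofReal_lt_conical_iff hlam).2 (hx.trans_le (lintegral_mono_set ?_))
  rintro p ⟨⟨h0, hp⟩, hhp⟩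
  refine ⟨h0, ?_⟩
  have h1 : ‖y - p.1‖ ≤ ‖y - x‖ + ‖x - p.1‖ := norm_sub_le_norm_sub_add_norm_sub _ _ _
  have h2 : ‖y - x‖ ≤ h := mem_closedBall_iff_norm.1 hy
  linarith

theorem exists_lt_lintegral_cone {w : EuclideanSpace ℝ (Fin n) × ℝ → ℝ≥0∞} {L : ℝ≥0∞}
    {x : EuclideanSpace ℝ (Fin n)} (hx : L < ∫⁻ p in cone 1 x, w p) :
    ∃ h : ℝ, 0 < h ∧ L < ∫⁻ p in {p | p ∈ cone 1 x ∧ h < p.2}, w p := by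
  set s : ℕ → Set (EuclideanSpace ℝ (Fin n) × ℝ) :=
    fun k => {p | p ∈ cone 1 x ∧ 1 / ((k : ℝ) + 1) < p.2} with hs
  have hsm : ∀ k, MeasurableSet (s k) := fun k =>
    (measurableSet_cone 1 x).inter (measurableSet_lt measurable_const measurable_snd)
  have hmono : Monotone s := fun i j hij p hp =>
    ⟨hp.1, (one_div_le_one_div_of_le (by positivity) (by gcongr)).trans_lt hp.2⟩
  have hU : ⋃ k, s k = cone 1 x := by
    refine Subset.antisymm (iUnion_subset fun k p hp => hp.1) fun p hp => ?_
    obtain ⟨k, hk⟩ := exists_nat_one_div_lt (show (0 : ℝ) < p.2 from hp.1)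
    exact mem_iUnion.2 ⟨k, hp, hk⟩
  have ht := tendsto_measure_iUnion_atTop (μ := volume.withDensity w) hmono
  rw [hU, withDensity_apply _ (measurableSet_cone 1 x)] at ht
  obtain ⟨k, hk⟩ := (ht.eventually_const_lt hx).exists
  refine ⟨1 / ((k : ℝ) + 1), by positivity, ?_⟩
  rwa [Function.comp_apply, withDensity_apply _ (hsm k)] at hk

/-- Balls of bounded volume have bounded radius; this fails in dimension zero. -/
theorem exists_radius_bound (hn : 0 < n) {V : ℝ≥0∞} (hV : V ≠ ∞) :
    ∃ R : ℝ, ∀ (x : EuclideanSpace ℝ (Fin n)) (h : ℝ),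
      volume (Metric.closedBall x h) ≤ V → h ≤ R := by
  set ω := volume (Metric.ball (0 : EuclideanSpace ℝ (Fin n)) 1)
  have hω0 : ω ≠ 0 := (Metric.measure_ball_pos _ _ one_pos).ne'
  have hωtop : ω ≠ ∞ := measure_ball_lt_top.ne
  refine ⟨max 1 (V / ω).toReal, fun x h hxh => ?_⟩
  rcases le_total h 1 with h1 | h1
  · exact h1.trans (le_max_left _ _)
  · refine le_trans ?_ (le_max_right _ _)
    have h0 : 0 ≤ h := zero_le_one.trans h1
    rw [Measure.addHaar_closedBall _ _ h0, finrank_euclideanSpace_fin,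
      ← ENNReal.le_div_iff_mul_le (Or.inl hω0) (Or.inl hωtop),
      ENNReal.ofReal_le_iff_le_toReal (ENNReal.div_ne_top hV hω0)] at hxh
    exact (le_self_pow₀ h1 hn.ne').trans hxh

/-- The good-`λ` inequality with the prefactor `2 * 4 ^ n` coming from the covering by balls. -/
theorem volume_good_lambda_le (hn : 0 < n) {f : EuclideanSpace ℝ (Fin n) × ℝ → ℝ}
    (hf : Measurable f) {lam β : ℝ} (hlam : 0 < lam) (hβ : 0 < β) :
    volume {x : EuclideanSpace ℝ (Fin n) |
        ENNReal.ofReal (2 * lam) < conical 1 f x ∧ carleson f x ≤ ENNReal.ofReal β} ≤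
      ENNReal.ofReal (2 * 4 ^ n * Real.exp (-(3 * lam ^ 2 / (2 * 3 ^ n *
        (volume.real (Metric.ball (0 : EuclideanSpace ℝ (Fin n)) 1) * β ^ 2))))) *
        volume {x : EuclideanSpace ℝ (Fin n) | ENNReal.ofReal lam < conical 2 f x} := by
  set Ω := {x : EuclideanSpace ℝ (Fin n) | ENNReal.ofReal lam < conical 2 f x}
  set E := {x : EuclideanSpace ℝ (Fin n) | carleson f x ≤ ENNReal.ofReal β} with hE
  set bad := {x : EuclideanSpace ℝ (Fin n) |
    ENNReal.ofReal (2 * lam) < conical 1 f x ∧ carleson f x ≤ ENNReal.ofReal β}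
  set K := volume.real (Metric.ball (0 : EuclideanSpace ℝ (Fin n)) 1) * β ^ 2
  set ε := Real.exp (-(3 * lam ^ 2 / (2 * 3 ^ n * K)))
  have hK : 0 < K := mul_pos
    (ENNReal.toReal_pos (Metric.measure_ball_pos _ _ one_pos).ne' measure_ball_lt_top.ne)
    (by positivity)
  -- if `Ω` has infinite measure there is nothing to prove; otherwise the radii are bounded
  by_cases hΩtop : volume Ω = ∞
  · rw [hΩtop, ENNReal.mul_top (by simp; positivity)]
    exact le_top
  obtain ⟨R, hR⟩ := exists_radius_bound hn hΩtop
  -- the scale at which the outer part of the square function passes the level `lam`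
  have hheight : ∀ x ∈ bad, ∃ h, 0 < h ∧
      ENNReal.ofReal (lam ^ 2) < ∫⁻ p in {p | p ∈ cone 1 x ∧ h < p.2}, squareDensity f p ∧
      ∫⁻ p in {p | p ∈ cone 1 x ∧ 2 * h < p.2}, squareDensity f p ≤ ENNReal.ofReal (lam ^ 2) := by
    intro x hx
    have h1 := (ofReal_lt_conical_iff (by positivity)).1 hx.1
    have h2 : ENNReal.ofReal (lam ^ 2) < ∫⁻ p in cone 1 x, squareDensity f p :=
      (ENNReal.ofReal_le_ofReal (by nlinarith)).trans_lt h1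
    obtain ⟨h₀, hh₀, hlt⟩ := exists_lt_lintegral_cone h2
    exact exists_lt_and_two_mul_le
      (φ := fun h => ∫⁻ p in {p | p ∈ cone 1 x ∧ h < p.2}, squareDensity f p) hh₀ hlt
      fun h _ hlt' => hR x h (measure_mono (closedBall_subset_of_lt_lintegral_cone hlam.le hlt'))
  choose! h hpos houter hinner using hheight
  obtain ⟨u, hub, hdisj, hcov⟩ := Vitali.exists_disjoint_subfamily_covering_enlargement
    (fun x => Metric.closedBall x (h x)) bad h 2 one_lt_two (fun x hx => (hpos x hx).le) R
    (fun x hx => hR x (h x)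
      (measure_mono (closedBall_subset_of_lt_lintegral_cone hlam.le (houter x hx))))
    (fun x hx => ⟨x, Metric.mem_closedBall_self (hpos x hx).le⟩)
  have hucount : u.Countable := hdisj.countable_of_nonempty_interior fun x hx =>
    ⟨x, Metric.ball_subset_interior_closedBall (Metric.mem_ball_self (hpos x (hub hx)))⟩
  set w := (sawtooth E).indicator (squareDensity f) with hw
  have hwm : Measurable w := (measurable_squareDensity hf).indicator (measurableSet_sawtooth E)
  set D : EuclideanSpace ℝ (Fin n) → Set (EuclideanSpace ℝ (Fin n)) := fun b =>
    {x ∈ Metric.ball b (4 * h b) | ENNReal.ofReal (3 * lam ^ 2) ≤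
      ∫⁻ p in {p | p ∈ cone 1 x ∧ p.2 ≤ 4 * h b}, w p}
  have hbadD : bad ⊆ ⋃ b ∈ u, D b := by
    intro x hx
    obtain ⟨b, hbu, ⟨y, hyx, hyb⟩, hxb⟩ := hcov x hx
    have hb0 := hpos b (hub hbu)
    -- the centres are at distance at most `h x + h b ≤ 3 * h b`, and `2 * h x ≤ 4 * h b`
    refine mem_iUnion₂.2 ⟨b, hbu, ?_, ?_⟩
    · have h1 : dist x b ≤ dist y x + dist y b := dist_triangle_left _ _ _
      rw [Metric.mem_closedBall] at hyx hyb
      rw [Metric.mem_ball]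
      linarith
    · have hcone : MeasurableSet (cone 1 x) := measurableSet_cone 1 x
      have hle : MeasurableSet {p : EuclideanSpace ℝ (Fin n) × ℝ | 2 * h x < p.2} :=
        measurableSet_lt measurable_const measurable_snd
      have hsplit := lintegral_inter_add_sdiff (μ := volume) (squareDensity f) (cone 1 x) hle
      have h1 : ENNReal.ofReal (3 * lam ^ 2) + ENNReal.ofReal (lam ^ 2) ≤
          (∫⁻ p in cone 1 x \ {p | 2 * h x < p.2}, squareDensity f p) +
            ENNReal.ofReal (lam ^ 2) := by
        rw [← ENNReal.ofReal_add (by positivity) (by positivity)]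
        have h2 := (ofReal_lt_conical_iff (by positivity)).1 hx.1
        rw [← hsplit, add_comm] at h2
        refine le_trans (le_of_eq (by congr 1; ring)) (h2.le.trans ?_)
        gcongr
        exact hinner x hx
      have h3 := ENNReal.le_of_add_le_add_right ENNReal.ofReal_ne_top h1
      refine h3.trans ?_
      have hsub : cone 1 x \ {p | 2 * h x < p.2} ⊆ {p | p ∈ cone 1 x ∧ p.2 ≤ 4 * h b} := by
        rintro p ⟨hp, hp2⟩
        have hp3 : p.2 ≤ 2 * h x := not_lt.1 hp2
        exact ⟨hp, by linarith⟩
      refine le_trans (le_of_eq ?_) (lintegral_mono_set hsub)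
      refine setLIntegral_congr_fun (hcone.diff hle) fun p hp => ?_
      have hpS : p ∈ sawtooth E := mem_iUnion₂.2 ⟨x, hx.2, hp.1⟩
      rw [hw, indicator_of_mem hpS]
  have hDle : ∀ b ∈ u, volume (D b) ≤
      ENNReal.ofReal (2 * 4 ^ n * ε) * volume (Metric.closedBall b (h b)) := by
    intro b hb
    have hb0 := hpos b (hub hb)
    have hvol : volume (Metric.ball b (4 * h b)) =
        ENNReal.ofReal (4 ^ n) * volume (Metric.closedBall b (h b)) := by
      rw [Measure.addHaar_ball_of_pos _ _ (by positivity), Measure.addHaar_closedBall _ _ hb0.le,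
        finrank_euclideanSpace_fin, mul_pow, ENNReal.ofReal_mul (by positivity), mul_assoc]
    refine (volume_truncated_cone_integral_ge_le hwm hK
      (fun z r _ => lintegral_tent_sawtooth_le hβ.le (fun x hx => hx) z r) b
      (by positivity : 0 < 4 * h b) (by positivity)).trans (le_of_eq ?_)
    rw [hvol, ← mul_assoc (ENNReal.ofReal _), ← ENNReal.ofReal_mul (by positivity),
      mul_right_comm 2 (4 ^ n)]
  calc volume bad ≤ volume (⋃ b ∈ u, D b) := measure_mono hbadD
    _ ≤ ∑' b : u, volume (D b) := measure_biUnion_le _ hucount _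
    _ ≤ ∑' b : u, ENNReal.ofReal (2 * 4 ^ n * ε) *
          volume (Metric.closedBall (b : EuclideanSpace ℝ (Fin n)) (h b)) :=
        ENNReal.tsum_le_tsum fun b => hDle b b.2
    _ = ENNReal.ofReal (2 * 4 ^ n * ε) * volume (⋃ b ∈ u, Metric.closedBall b (h b)) := by
        rw [ENNReal.tsum_mul_left,
          measure_biUnion hucount hdisj fun _ _ => Metric.isClosed_closedBall.measurableSet]
    _ ≤ ENNReal.ofReal (2 * 4 ^ n * ε) * volume Ω := by
        gcongr
        exact iUnion₂_subset fun b hb =>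
          closedBall_subset_of_lt_lintegral_cone hlam.le (houter b (hub hb))

theorem setOf_lt_conical_one_subset {f : EuclideanSpace ℝ (Fin n) × ℝ → ℝ} {lam : ℝ}
    (hlam : 0 < lam) :
    {x : EuclideanSpace ℝ (Fin n) | ENNReal.ofReal (2 * lam) < conical 1 f x} ⊆
      {x | ENNReal.ofReal lam < conical 2 f x} := by
  intro x hx
  rw [mem_ofPred_eq] at hx
  rw [ofReal_lt_conical_iff (by positivity)] at hx
  refine (ofReal_lt_conical_iff hlam.le).2 (((ENNReal.ofReal_le_ofReal ?_).trans_lt hx).trans_le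
    (lintegral_mono_set ?_))
  · nlinarith
  · rintro p ⟨h0, hp⟩
    have h0' : 0 < p.2 := h0
    exact ⟨h0, by linarith⟩

end GoodLambda

end TentSpace

theorem theorem6p2 (n : ℕ) (hn : 0 < n) :
    ∃ α c : ℝ, 1 < α ∧ 0 < c ∧
      ∀ f : EuclideanSpace ℝ (Fin n) × ℝ → ℝ,
        AEMeasurable f (volume.restrict (TentSpace.upperHalfSpace n)) →
        ∀ lam γ : ℝ, 0 < lam → 0 < γ → γ ≤ 1 →
          volume {x : EuclideanSpace ℝ (Fin n) |
              ENNReal.ofReal (2 * lam) < TentSpace.conical 1 f x ∧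
              TentSpace.carleson f x ≤ ENNReal.ofReal (γ * lam)} ≤
            ENNReal.ofReal (2 * Real.exp (-c / γ ^ 2)) *
              volume {x : EuclideanSpace ℝ (Fin n) |
                ENNReal.ofReal lam < TentSpace.conical α f x} := by
  set ω := volume.real (Metric.ball (0 : EuclideanSpace ℝ (Fin n)) 1)
  have hω0 : 0 < ω :=
    ENNReal.toReal_pos (Metric.measure_ball_pos _ _ one_pos).ne' measure_ball_lt_top.ne
  set c : ℝ := 3 / (2 * 3 ^ n * ω) / (2 * n + 1) with hc
  refine ⟨2, c, one_lt_two, by positivity, fun f hf lam γ hlam hγ _ => ?_⟩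
  obtain ⟨g, hg, hfg⟩ := hf
  rw [TentSpace.conical_congr_ae hfg, TentSpace.conical_congr_ae hfg,
    TentSpace.carleson_congr_ae hfg]
  set q := 2 * Real.exp (-c / γ ^ 2) with hq
  have hq0 : 0 ≤ q := by positivity
  -- the trivial bound and the exponential bound combine through `min 1 (q ^ (2 * n + 1)) ≤ q`
  rcases le_total 1 q with h1 | h1
  · calc _ ≤ volume {x : EuclideanSpace ℝ (Fin n) |
            ENNReal.ofReal lam < TentSpace.conical 2 g x} :=
          measure_mono fun x hx => TentSpace.setOf_lt_conical_one_subset hlam hx.1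
      _ ≤ _ := le_mul_of_one_le_left' (ENNReal.one_le_ofReal.2 h1)
  · refine (TentSpace.volume_good_lambda_le hn hg hlam (mul_pos hγ hlam)).trans ?_
    gcongr
    calc 2 * 4 ^ n * Real.exp (-(3 * lam ^ 2 / (2 * 3 ^ n * (ω * (γ * lam) ^ 2))))
        = q ^ (2 * n + 1) := by
          have hexp : Real.exp (-c / γ ^ 2) ^ (2 * n + 1) =
              Real.exp (-(3 * lam ^ 2 / (2 * 3 ^ n * (ω * (γ * lam) ^ 2)))) := by
            rw [← Real.exp_nat_mul, hc]
            congr 1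
            push_cast
            field_simp
          rw [hq, mul_pow (2 : ℝ) (Real.exp _), hexp,
            pow_succ (2 : ℝ) (2 * n), pow_mul (2 : ℝ)]
          norm_num [mul_comm]
      _ ≤ q := pow_le_of_le_one hq0 h1 (by omega)
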